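/- Let $q\in(0,1)$ and let $k,l$ be coprime positive integers. Let $U_q(\mathfrak{su}_2)$ be the complex unital algebra generated by $e,f,\kappa,\kappa^{-1}$ with relations $\kappa e=q\,e\kappa$, $\kappa f=q^{-1}f\kappa$, $[e,f]=\frac{\kappa^2-\kappa^{-2}}{q-q^{-1}}$, $\kappa\kappa^{-1}=\kappa^{-1}\kappa=1$, and with coproduct $\triangle(\kappa)=\kappa\otimes\kappa$, $\triangle(e)=e\otimes\kappa+\kappa^{-1}\otimes e$, $\triangle(f)=f\otimes\kappa+\kappa^{-1}\otimes f$ and counit $\epsilon(\kappa)=1$, $\epsilon(e)=\epsilon(f)=0$. For $\lambda\in\frac12\mathbb{N}_0$ let $\varrho_\lambda$ be its irreducible representation with basis $u_{\lambda m}$, $m=-\lambda,-\lambda+1,\dots,\lambda$, given by $\varrho_\lambda(e)u_{\lambda m}=\sqrt{[\lambda-m]_q[\lambda+m+1]_q}\,u_{\lambda,m+1}$, $\varrho_\lambda(f)u_{\lambda m}=\sqrt{[\lambda-m+1]_q[\lambda+m]_q}\,u_{\lambda,m-1}$, $\varrho_\lambda(\kappa)u_{\lambda m}=q^mu_{\lambda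 m}$, where $[n]_q=\frac{q^n-q^{-n}}{q-q^{-1}}$. Let $\mathbb{C}[SU_{2,q}]$ be the algebra of matrix elements $t^\lambda_{mn}(x)=u^*_{\lambda m}(\varrho_\lambda(x)u_{\lambda n})$, with product $(st)(x)=s(x')t(x'')$ where $\triangle(x)=x'\otimes x''$, and let $\partial$ be the right regular representation of $U_q(\mathfrak{su}_2)$ on it, $(\partial(x)t)(y)=t(yx)$. Let $B=\mathbb{C}[u,u^{-1}]$ be the Hopf algebra with $u$ grouplike, and let $\theta_0:\mathbb{C}[SU_{2,q}]\to\mathbb{C}[SU_{2,q}]\otimes B$ be the coaction which is an algebra homomorphism with $\alpha\mapsto\alpha\otimes u^{-k}$, $\beta\mapsto\beta\otimes u^{l}$, $\alpha^*\mapsto\alpha^*\otimes u^{k}$, $\beta^*\mapsto\beta^*\otimes u^{-l}$, where $\alpha=t^{1/2}_{1/2,1/2}$, $\beta=t^{1/2}_{1/2,-1/2}$, $\alpha^*=t^{1/2}_{-1/2,-1/2}$, $\beta^*=-q^{-1}t^{1/2}_{-1/2,1/2}$. Then there is a unique coaction $\theta:U_q(\mathfrak{su}_2)\to U_q(\mathfrak{su}_2)\otimes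 B$ of $B$ on the vector space $U_q(\mathfrak{su}_2)$ (that is, a linear map with $(\theta\otimes\iota)\theta=(\iota\otimes\triangle)\theta$ and $(\iota\otimes\epsilon)\theta=\iota$) which is right equivariant: $$\theta_0(\partial(x)t)=(\partial\otimes\iota)(\theta(x))\,\theta_0(t)\qquad\text{for all }x\in U_q(\mathfrak{su}_2),\ t\in\mathbb{C}[SU_{2,q}].$$ It is given on the generators by $\theta(e)=e\otimes u^{-k-l}$, $\theta(f)=f\otimes u^{k+l}$, $\theta(\kappa^{\pm1})=\kappa^{\pm1}\otimes1$, and it is an algebra homomorphism. -/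

import Mathlib

open scoped TensorProduct LaurentPolynomial

noncomputable section

namespace QuantumSU2

/-! ### The Drinfeld–Jimbo algebra `U_q(su₂)` -/

/-- The four generators `e, f, k, k⁻¹`. -/
inductive Gen : Type
  | e | f | k | kInv

/-- The defining relations of `U_q(su₂)` in the free algebra on `e, f, k, k⁻¹`:
`k e = q e k`, `k f = q⁻¹ f k`, `[e, f] = (k² - k⁻²) / (q - q⁻¹)`, `k k⁻¹ = k⁻¹ k = 1`. -/
inductive Rel (q : Set.Ioo (0 : ℝ) 1) : FreeAlgebra ℂ Gen → FreeAlgebra ℂ Gen → Prop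
  | ke : Rel q (FreeAlgebra.ι ℂ Gen.k * FreeAlgebra.ι ℂ Gen.e)
      (((q : ℝ) : ℂ) • (FreeAlgebra.ι ℂ Gen.e * FreeAlgebra.ι ℂ Gen.k))
  | kf : Rel q (FreeAlgebra.ι ℂ Gen.k * FreeAlgebra.ι ℂ Gen.f)
      (((q : ℝ) : ℂ)⁻¹ • (FreeAlgebra.ι ℂ Gen.f * FreeAlgebra.ι ℂ Gen.k))
  | ef : Rel q (FreeAlgebra.ι ℂ Gen.e * FreeAlgebra.ι ℂ Gen.f -
        FreeAlgebra.ι ℂ Gen.f * FreeAlgebra.ι ℂ Gen.e)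
      ((((q : ℝ) : ℂ) - ((q : ℝ) : ℂ)⁻¹)⁻¹ •
        (FreeAlgebra.ι ℂ Gen.k ^ 2 - FreeAlgebra.ι ℂ Gen.kInv ^ 2))
  | kkInv : Rel q (FreeAlgebra.ι ℂ Gen.k * FreeAlgebra.ι ℂ Gen.kInv) 1
  | kInvk : Rel q (FreeAlgebra.ι ℂ Gen.kInv * FreeAlgebra.ι ℂ Gen.k) 1

/-- `U_q(su₂)`: the complex unital algebra generated by `e, f, k, k⁻¹` subject to `Rel q`. -/
abbrev Uq (q : Set.Ioo (0 : ℝ) 1) : Type := RingQuot (Rel q)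

namespace Uq

variable (q : Set.Ioo (0 : ℝ) 1)

/-- The image of a generator in `U_q(su₂)`. -/
def gen (g : Gen) : Uq q := RingQuot.mkAlgHom ℂ (Rel q) (FreeAlgebra.ι ℂ g)

/-- The generator `e`. -/
def e : Uq q := gen q Gen.e
/-- The generator `f`. -/
def f : Uq q := gen q Gen.f
/-- The generator `k`. -/
def k : Uq q := gen q Gen.k
/-- The generator `k⁻¹`. -/
def kInv : Uq q := gen q Gen.kInv

theorem k_mul_e : k q * e q = ((q : ℝ) : ℂ) • (e q * k q) := by
  have h := RingQuot.mkAlgHom_rel ℂ (Rel.ke (q := q))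
  rwa [map_mul, map_smul, map_mul] at h

theorem k_mul_f : k q * f q = ((q : ℝ) : ℂ)⁻¹ • (f q * k q) := by
  have h := RingQuot.mkAlgHom_rel ℂ (Rel.kf (q := q))
  rwa [map_mul, map_smul, map_mul] at h

theorem e_mul_f_sub : e q * f q - f q * e q =
    (((q : ℝ) : ℂ) - ((q : ℝ) : ℂ)⁻¹)⁻¹ • (k q ^ 2 - kInv q ^ 2) := by
  have h := RingQuot.mkAlgHom_rel ℂ (Rel.ef (q := q))
  rwa [map_sub, map_mul, map_mul, map_smul, map_sub, map_pow, map_pow] at h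

theorem k_mul_kInv : k q * kInv q = 1 := by
  have h := RingQuot.mkAlgHom_rel ℂ (Rel.kkInv (q := q))
  rwa [map_mul, map_one] at h

theorem kInv_mul_k : kInv q * k q = 1 := by
  have h := RingQuot.mkAlgHom_rel ℂ (Rel.kInvk (q := q))
  rwa [map_mul, map_one] at h

theorem q_ne_zero : ((q : ℝ) : ℂ) ≠ 0 := by
  exact_mod_cast q.2.1.ne'

theorem e_mul_kInv : e q * kInv q = ((q : ℝ) : ℂ) • (kInv q * e q) := by
  calc e q * kInv q = kInv q * (k q * e q) * kInv q := by
        rw [← mul_assoc, kInv_mul_k, one_mul]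
    _ = ((q : ℝ) : ℂ) • (kInv q * e q * (k q * kInv q)) := by
        rw [k_mul_e]; simp only [mul_smul_comm, smul_mul_assoc, mul_assoc]
    _ = _ := by rw [k_mul_kInv, mul_one]

theorem f_mul_kInv : f q * kInv q = ((q : ℝ) : ℂ)⁻¹ • (kInv q * f q) := by
  calc f q * kInv q = kInv q * (k q * f q) * kInv q := by
        rw [← mul_assoc, kInv_mul_k, one_mul]
    _ = ((q : ℝ) : ℂ)⁻¹ • (kInv q * f q * (k q * kInv q)) := by
        rw [k_mul_f]; simp only [mul_smul_comm, smul_mul_assoc, mul_assoc]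
    _ = _ := by rw [k_mul_kInv, mul_one]

variable {q}

/-- The universal property of `U_q(su₂)`: images of the four generators that satisfy the
relations determine an algebra homomorphism. -/
def lift {A : Type*} [Ring A] [Algebra ℂ A] (E F K L : A)
    (hKE : K * E = ((q : ℝ) : ℂ) • (E * K)) (hKF : K * F = ((q : ℝ) : ℂ)⁻¹ • (F * K))
    (hEF : E * F - F * E = (((q : ℝ) : ℂ) - ((q : ℝ) : ℂ)⁻¹)⁻¹ • (K ^ 2 - L ^ 2))
    (hKL : K * L = 1) (hLK : L * K = 1) : Uq q →ₐ[ℂ] A :=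
  RingQuot.liftAlgHom ℂ ⟨FreeAlgebra.lift ℂ (fun g : Gen => match g with
    | .e => E | .f => F | .k => K | .kInv => L), by
    intro x y h
    cases h <;> simp only [map_mul, map_smul, map_sub, map_pow, map_one,
      FreeAlgebra.lift_ι_apply] <;> assumption⟩

section lift
variable {A : Type*} [Ring A] [Algebra ℂ A] {E F K L : A}
  (hKE : K * E = ((q : ℝ) : ℂ) • (E * K)) (hKF : K * F = ((q : ℝ) : ℂ)⁻¹ • (F * K))
  (hEF : E * F - F * E = (((q : ℝ) : ℂ) - ((q : ℝ) : ℂ)⁻¹)⁻¹ • (K ^ 2 - L ^ 2))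
  (hKL : K * L = 1) (hLK : L * K = 1)

theorem lift_e : lift E F K L hKE hKF hEF hKL hLK (e q) = E := by simp [lift, e, gen]
theorem lift_f : lift E F K L hKE hKF hEF hKL hLK (f q) = F := by simp [lift, f, gen]
theorem lift_k : lift E F K L hKE hKF hEF hKL hLK (k q) = K := by simp [lift, k, gen]
theorem lift_kInv : lift E F K L hKE hKF hEF hKL hLK (kInv q) = L := by simp [lift, kInv, gen]
end lift

theorem algHom_ext {A : Type*} [Semiring A] [Algebra ℂ A] {φ ψ : Uq q →ₐ[ℂ] A}
    (he : φ (e q) = ψ (e q)) (hf : φ (f q) = ψ (f q)) (hk : φ (k q) = ψ (k q))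
    (hl : φ (kInv q) = ψ (kInv q)) : φ = ψ := by
  refine RingQuot.ringQuot_ext' ℂ _ _ (FreeAlgebra.hom_ext (funext fun g => ?_))
  cases g
  · exact he
  · exact hf
  · exact hk
  · exact hl

variable (q)

/-- The coproduct: `Δ k = k ⊗ k`, `Δ e = e ⊗ k + k⁻¹ ⊗ e`, `Δ f = f ⊗ k + k⁻¹ ⊗ f`. -/
def comulHom : Uq q →ₐ[ℂ] Uq q ⊗[ℂ] Uq q :=
  lift (q := q) (e q ⊗ₜ[ℂ] k q + kInv q ⊗ₜ e q) (f q ⊗ₜ k q + kInv q ⊗ₜ f q) (k q ⊗ₜ k q)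
    (kInv q ⊗ₜ kInv q)
    (by
      simp only [mul_add, add_mul, Algebra.TensorProduct.tmul_mul_tmul, k_mul_e, k_mul_kInv,
        kInv_mul_k, smul_add, TensorProduct.smul_tmul', TensorProduct.tmul_smul])
    (by
      simp only [mul_add, add_mul, Algebra.TensorProduct.tmul_mul_tmul, k_mul_f, k_mul_kInv,
        kInv_mul_k, smul_add, TensorProduct.smul_tmul', TensorProduct.tmul_smul])
    (by
      have hef := e_mul_f_sub q
      have h1 : (e q * kInv q) ⊗ₜ[ℂ] (k q * f q) = (kInv q * e q) ⊗ₜ[ℂ] (f q * k q) := by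
        rw [e_mul_kInv, k_mul_f, TensorProduct.smul_tmul_smul, mul_inv_cancel₀ (q_ne_zero q),
          one_smul]
      have h2 : (f q * kInv q) ⊗ₜ[ℂ] (k q * e q) = (kInv q * f q) ⊗ₜ[ℂ] (e q * k q) := by
        rw [f_mul_kInv, k_mul_e, TensorProduct.smul_tmul_smul, inv_mul_cancel₀ (q_ne_zero q),
          one_smul]
      have h3 : e q * f q = f q * e q +
          (((q : ℝ) : ℂ) - ((q : ℝ) : ℂ)⁻¹)⁻¹ • (k q ^ 2 - kInv q ^ 2) := by
        rw [← hef]; abel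
      simp only [mul_add, add_mul, pow_two, Algebra.TensorProduct.tmul_mul_tmul, h1, h2, h3,
        TensorProduct.add_tmul, TensorProduct.tmul_add, TensorProduct.smul_tmul',
        TensorProduct.tmul_smul, TensorProduct.sub_tmul, TensorProduct.tmul_sub, smul_sub]
      abel)
    (by simp only [Algebra.TensorProduct.tmul_mul_tmul, k_mul_kInv]; rfl)
    (by simp only [Algebra.TensorProduct.tmul_mul_tmul, kInv_mul_k]; rfl)

/-- The counit: `ε k = 1`, `ε e = ε f = 0`. -/
def counitHom : Uq q →ₐ[ℂ] ℂ :=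
  lift (q := q) 0 0 1 1 (by simp) (by simp) (by simp) (by simp) (by simp)

@[simp] theorem comulHom_e : comulHom q (e q) = e q ⊗ₜ k q + kInv q ⊗ₜ e q := lift_e ..
@[simp] theorem comulHom_f : comulHom q (f q) = f q ⊗ₜ k q + kInv q ⊗ₜ f q := lift_f ..
@[simp] theorem comulHom_k : comulHom q (k q) = k q ⊗ₜ k q := lift_k ..
@[simp] theorem comulHom_kInv : comulHom q (kInv q) = kInv q ⊗ₜ kInv q := lift_kInv ..
@[simp] theorem counitHom_e : counitHom q (e q) = 0 := lift_e ..
@[simp] theorem counitHom_f : counitHom q (f q) = 0 := lift_f ..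
@[simp] theorem counitHom_k : counitHom q (k q) = 1 := lift_k ..
@[simp] theorem counitHom_kInv : counitHom q (kInv q) = 1 := lift_kInv ..

/-- `U_q(su₂)` is a bialgebra (in fact a Hopf algebra; the antipode is not needed here). -/
instance : Bialgebra ℂ (Uq q) :=
  Bialgebra.ofAlgHom (comulHom q) (counitHom q)
    (algHom_ext
      (by simp [TensorProduct.add_tmul, TensorProduct.tmul_add, add_assoc])
      (by simp [TensorProduct.add_tmul, TensorProduct.tmul_add, add_assoc])
      (by simp) (by simp))
    (algHom_ext (by simp) (by simp) (by simp) (by simp))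
    (algHom_ext (by simp) (by simp) (by simp) (by simp))

theorem comul_eq (x : Uq q) : Coalgebra.comul (R := ℂ) x = comulHom q x := rfl

theorem counit_eq (x : Uq q) : Coalgebra.counit (R := ℂ) x = counitHom q x := rfl

/-- `k` as an invertible element, so that the powers `k ^ n` with `n : ℤ` make sense. -/
def kUnit : (Uq q)ˣ := ⟨k q, kInv q, k_mul_kInv q, kInv_mul_k q⟩

end Uq

/-! ### The irreducible representations `M_λ` -/

/-- The `q`-number `[x]_q = (q ^ x - q ^ (-x)) / (q - q⁻¹)`. -/
def qNum (q : Set.Ioo (0 : ℝ) 1) (x : ℝ) : ℝ :=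
  ((q : ℝ) ^ x - (q : ℝ) ^ (-x)) / ((q : ℝ) - (q : ℝ)⁻¹)

/-- For the highest weight `λ = N / 2`, the basis of `M_λ` is indexed by `i : Fin (N + 1)`; the
`i`-th basis vector has weight `m = i - λ`, so that `m` runs over `-λ, -λ + 1, …, λ`. -/
def wt (N : ℕ) (i : Fin (N + 1)) : ℝ := (i : ℕ) - (N : ℝ) / 2

section Rep

variable (q : Set.Ioo (0 : ℝ) 1) (N : ℕ)

/-- The matrix of `e` on `M_{N/2}`: `e u_m = √([λ - m]_q [λ + m + 1]_q) u_{m + 1}`. -/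
def matE : Matrix (Fin (N + 1)) (Fin (N + 1)) ℂ := Matrix.of fun i j =>
  if (i : ℕ) = j + 1 then
    ((√(qNum q ((N : ℝ) / 2 - wt N j) * qNum q ((N : ℝ) / 2 + wt N j + 1)) : ℝ) : ℂ) else 0

/-- The matrix of `f` on `M_{N/2}`: `f u_m = √([λ - m + 1]_q [λ + m]_q) u_{m - 1}`. -/
def matF : Matrix (Fin (N + 1)) (Fin (N + 1)) ℂ := Matrix.of fun i j =>
  if (i : ℕ) + 1 = j then
    ((√(qNum q ((N : ℝ) / 2 - wt N j + 1) * qNum q ((N : ℝ) / 2 + wt N j)) : ℝ) : ℂ) else 0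

/-- The matrix of `k` on `M_{N/2}`: `k u_m = q ^ m u_m`. -/
def matK : Matrix (Fin (N + 1)) (Fin (N + 1)) ℂ :=
  Matrix.diagonal fun j => (((q : ℝ) ^ wt N j : ℝ) : ℂ)

/-- The matrix of `k⁻¹` on `M_{N/2}`: `k⁻¹ u_m = q ^ (-m) u_m`. -/
def matKInv : Matrix (Fin (N + 1)) (Fin (N + 1)) ℂ :=
  Matrix.diagonal fun j => (((q : ℝ) ^ (-wt N j) : ℝ) : ℂ)

theorem qNum_zero : qNum q 0 = 0 := by simp [qNum]

theorem q_sub_inv_neg : (q : ℝ) - (q : ℝ)⁻¹ < 0 := by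
  have h0 := q.2.1
  have h1 := q.2.2
  have : 1 < (q : ℝ)⁻¹ := (one_lt_inv₀ h0).2 h1
  linarith

theorem qNum_nonneg {x : ℝ} (hx : 0 ≤ x) : 0 ≤ qNum q x := by
  refine div_nonneg_of_nonpos ?_ (q_sub_inv_neg q).le
  have := Real.rpow_le_rpow_of_exponent_ge q.2.1 q.2.2.le (show -x ≤ x by linarith)
  linarith

theorem qNum_identity (l m : ℝ) :
    qNum q (l - m + 1) * qNum q (l + m) - qNum q (l - m) * qNum q (l + m + 1) =
      ((q : ℝ) - (q : ℝ)⁻¹)⁻¹ * (((q : ℝ) ^ m) ^ 2 - ((q : ℝ) ^ (-m)) ^ 2) := by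
  have h0 := q.2.1
  have hd : (q : ℝ) - (q : ℝ)⁻¹ ≠ 0 := (q_sub_inv_neg q).ne
  have ha : (q : ℝ) ^ l ≠ 0 := (Real.rpow_pos_of_pos h0 _).ne'
  have hb : (q : ℝ) ^ m ≠ 0 := (Real.rpow_pos_of_pos h0 _).ne'
  have hq : (q : ℝ) ≠ 0 := h0.ne'
  have h2 : (q : ℝ) ^ 2 - 1 ≠ 0 := by
    intro h; apply hd; field_simp; linarith
  simp only [qNum, Real.rpow_neg h0.le, Real.rpow_add h0, Real.rpow_sub h0, Real.rpow_one]
  field_simp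
  ring

theorem wt_le (j : Fin (N + 1)) : wt N j ≤ (N : ℝ) / 2 := by
  have : ((j : ℕ) : ℝ) ≤ N := by exact_mod_cast Nat.lt_succ_iff.1 j.2
  unfold wt; linarith

theorem neg_wt_le (j : Fin (N + 1)) : 0 ≤ (N : ℝ) / 2 + wt N j := by
  have : (0 : ℝ) ≤ ((j : ℕ) : ℝ) := by positivity
  unfold wt; linarith

theorem matE_mul_matF : matE q N * matF q N = Matrix.diagonal fun j =>
    ((qNum q ((N : ℝ) / 2 - wt N j + 1) * qNum q ((N : ℝ) / 2 + wt N j) : ℝ) : ℂ) := by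
  ext i j
  rw [Matrix.mul_apply]
  rcases j with ⟨j, hj⟩
  cases j with
  | zero =>
    rw [Finset.sum_eq_zero (fun p _ => by simp [matF])]
    simp only [Matrix.diagonal_apply]
    split_ifs with h
    · subst h
      have : (N : ℝ) / 2 + wt N ⟨0, hj⟩ = 0 := by simp [wt]
      rw [this, qNum_zero]; simp
    · rfl
  | succ j =>
    rw [Finset.sum_eq_single ⟨j, by omega⟩]
    · simp only [matE, matF, Matrix.of_apply, Matrix.diagonal_apply, Fin.ext_iff, if_true]
      split_ifs with h
      · have h1 : (N : ℝ) / 2 - wt N ⟨j, by omega⟩ = (N : ℝ) / 2 - wt N ⟨j + 1, hj⟩ + 1 := by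
          simp only [wt]; push_cast; ring
        have h2 : (N : ℝ) / 2 + wt N ⟨j, by omega⟩ + 1 = (N : ℝ) / 2 + wt N ⟨j + 1, hj⟩ := by
          simp only [wt]; push_cast; ring
        have hij : i = ⟨j + 1, hj⟩ := Fin.ext h
        rw [h1, h2, ← Complex.ofReal_mul, Real.mul_self_sqrt, hij]
        refine mul_nonneg (qNum_nonneg q ?_) (qNum_nonneg q (neg_wt_le N _))
        linarith [wt_le N ⟨j + 1, hj⟩]
      · simp
    · intro p _ hp
      have : ¬ ((p : ℕ) = j) := fun h => hp (Fin.ext h)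
      simp [matF, this]
    · simp

theorem matF_mul_matE : matF q N * matE q N = Matrix.diagonal fun j =>
    ((qNum q ((N : ℝ) / 2 - wt N j) * qNum q ((N : ℝ) / 2 + wt N j + 1) : ℝ) : ℂ) := by
  ext i j
  rw [Matrix.mul_apply]
  by_cases hj : (j : ℕ) = N
  · rw [Finset.sum_eq_zero (fun p _ => by
      have : ¬ ((p : ℕ) = j + 1) := by have := p.2; omega
      simp [matE, this])]
    have : (N : ℝ) / 2 - wt N j = 0 := by simp only [wt, hj]; ring
    rw [Matrix.diagonal_apply]
    split_ifs with h
    · rw [h, this, qNum_zero]; simp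
    · rfl
  · have hj' : (j : ℕ) + 1 < N + 1 := by have := j.2; omega
    rw [Finset.sum_eq_single ⟨j + 1, hj'⟩]
    · simp only [matE, matF, Matrix.of_apply, Matrix.diagonal_apply, Fin.ext_iff, if_true,
        Nat.add_right_cancel_iff]
      split_ifs with h
      · have h1 : (N : ℝ) / 2 - wt N ⟨j + 1, hj'⟩ + 1 = (N : ℝ) / 2 - wt N j := by
          simp only [wt]; push_cast; ring
        have h2 : (N : ℝ) / 2 + wt N ⟨j + 1, hj'⟩ = (N : ℝ) / 2 + wt N j + 1 := by
          simp only [wt]; push_cast; ring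
        have hij : i = j := Fin.ext h
        rw [h1, h2, ← Complex.ofReal_mul, Real.mul_self_sqrt, hij]
        refine mul_nonneg (qNum_nonneg q ?_) (qNum_nonneg q ?_)
        · linarith [wt_le N j]
        · linarith [neg_wt_le N j]
      · simp
    · intro p _ hp
      have : ¬ ((p : ℕ) = j + 1) := fun h => hp (Fin.ext (by simpa using h))
      simp [matE, this]
    · simp

/-- The irreducible representation `ϱ_λ` of `U_q(su₂)` of highest weight `λ = N / 2`, in matrix
form with respect to the basis `u_{λ,m}`. -/
def rep : Uq q →ₐ[ℂ] Matrix (Fin (N + 1)) (Fin (N + 1)) ℂ :=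
  Uq.lift (matE q N) (matF q N) (matK q N) (matKInv q N)
    (by
      ext i j
      simp only [matK, matE, Matrix.diagonal_mul, Matrix.mul_diagonal, Matrix.smul_apply,
        Matrix.of_apply, smul_eq_mul]
      split_ifs with h
      · have : wt N i = wt N j + 1 := by simp [wt, h]; ring
        rw [this, Real.rpow_add q.2.1, Real.rpow_one]; push_cast; ring
      · simp)
    (by
      ext i j
      simp only [matK, matF, Matrix.diagonal_mul, Matrix.mul_diagonal, Matrix.smul_apply,
        Matrix.of_apply, smul_eq_mul]
      split_ifs with h
      · have : wt N i = wt N j - 1 := by simp [wt, ← h]; ring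
        rw [this, Real.rpow_sub q.2.1, Real.rpow_one]; push_cast; ring
      · simp)
    (by
      rw [matE_mul_matF, matF_mul_matE, matK, matKInv, Matrix.diagonal_pow, Matrix.diagonal_pow,
        Matrix.diagonal_sub, Matrix.diagonal_sub, ← Matrix.diagonal_smul]
      congr 1
      funext j
      have h := qNum_identity q ((N : ℝ) / 2) (wt N j)
      simp only [Pi.smul_apply, Pi.pow_apply, smul_eq_mul]
      rw [← Complex.ofReal_sub, h]
      push_cast
      rfl)
    (by
      rw [matK, matKInv, Matrix.diagonal_mul_diagonal, ← Matrix.diagonal_one]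
      congr 1; funext j
      rw [← Complex.ofReal_mul, ← Real.rpow_add q.2.1]; simp)
    (by
      rw [matK, matKInv, Matrix.diagonal_mul_diagonal, ← Matrix.diagonal_one]
      congr 1; funext j
      rw [← Complex.ofReal_mul, ← Real.rpow_add q.2.1]; simp)

theorem rep_e : rep q N (Uq.e q) = matE q N := Uq.lift_e ..
theorem rep_f : rep q N (Uq.f q) = matF q N := Uq.lift_f ..
theorem rep_k : rep q N (Uq.k q) = matK q N := Uq.lift_k ..
theorem rep_kInv : rep q N (Uq.kInv q) = matKInv q N := Uq.lift_kInv ..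

end Rep

/-! ### The quantum group algebra `ℂ[SU_{2,q}]` -/

section Coord

variable (q : Set.Ioo (0 : ℝ) 1)

/-- The full dual algebra of `U_q(su₂)`: linear functionals with the convolution product
`(s t)(x) = s(x') t(x'')`, whose unit is the counit. -/
abbrev FullDual : Type := WithConv (Uq q →ₗ[ℂ] ℂ)

/-- The matrix element `t^λ_{mn}(x) = u*_{λ,m} (ϱ_λ(x) u_{λ,n})`, where `λ = N / 2`, `m = i - λ`,
`n = j - λ`. -/
def matrixElement (N : ℕ) (i j : Fin (N + 1)) : FullDual q :=
  WithConv.toConv (Matrix.entryLinearMap ℂ ℂ i j ∘ₗ (rep q N).toLinearMap)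

/-- The Hopf dual `ℂ[SU_{2,q}]`: the algebra of functionals on `U_q(su₂)` generated by the matrix
elements of all the irreducible representations `ϱ_λ`, `λ ∈ ½ℕ`. (By the Clebsch–Gordan
decomposition of `M_λ ⊗ M_λ'` the matrix elements also span it linearly, and the map
`⊕ M_λ* ⊗ M_λ → ℂ[SU_{2,q}]` is bijective.) -/
def coordAlgebra : Subalgebra ℂ (FullDual q) :=
  Algebra.adjoin ℂ {t | ∃ (N : ℕ) (i j : Fin (N + 1)), t = matrixElement q N i j}

/-- `ℂ[SU_{2,q}]` as a type. -/
abbrev CSU2 : Type := coordAlgebra q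

/-- The matrix element `t^λ_{mn}` as an element of `ℂ[SU_{2,q}]`. -/
def t (N : ℕ) (i j : Fin (N + 1)) : CSU2 q :=
  ⟨matrixElement q N i j, Algebra.subset_adjoin ⟨N, i, j, rfl⟩⟩

/-- `α = t^{1/2}_{1/2, 1/2}`. -/
def α : CSU2 q := t q 1 1 1
/-- `β = t^{1/2}_{1/2, -1/2}`. -/
def β : CSU2 q := t q 1 1 0
/-- `α* = t^{1/2}_{-1/2, -1/2}`. -/
def αStar : CSU2 q := t q 1 0 0
/-- `β* = - q⁻¹ t^{1/2}_{-1/2, 1/2}`. -/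
def βStar : CSU2 q := (-((q : ℝ) : ℂ)⁻¹) • t q 1 0 1

variable {q}

/-- The two-sided translate `z ↦ s (y z x)` of a functional `s`. -/
def translate (y x : Uq q) : FullDual q →ₗ[ℂ] FullDual q where
  toFun s := WithConv.toConv (s.ofConv ∘ₗ LinearMap.mulLeft ℂ y ∘ₗ LinearMap.mulRight ℂ x)
  map_add' _ _ := rfl
  map_smul' _ _ := rfl

theorem translate_apply (y x z : Uq q) (s : FullDual q) :
    translate y x s z = s (y * (z * x)) := rfl

theorem translate_matrixElement (y x : Uq q) (N : ℕ) (i j : Fin (N + 1)) :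
    translate y x (matrixElement q N i j) =
      ∑ a, ∑ b, (rep q N y i a * rep q N x b j) • matrixElement q N a b := by
  ext z
  simp only [translate_apply, matrixElement, LinearMap.comp_apply,
    AlgHom.toLinearMap_apply, Matrix.entryLinearMap_apply, map_mul, Matrix.mul_apply,
    WithConv.ofConv_sum, WithConv.ofConv_smul, LinearMap.sum_apply, LinearMap.smul_apply,
    smul_eq_mul, Finset.mul_sum]
  exact Finset.sum_congr rfl fun a _ => Finset.sum_congr rfl fun b _ => by ring

theorem translate_mul {ι κ : Type*} (y x : Uq q) (Y : Coalgebra.Repr ℂ y ι)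
    (X : Coalgebra.Repr ℂ x κ) (r s : FullDual q) :
    translate y x (r * s) = ∑ a ∈ Y.index, ∑ b ∈ X.index,
      translate (Y.left a) (X.left b) r * translate (Y.right a) (X.right b) s := by
  ext z
  have Z := Coalgebra.Repr.arbitrary ℂ z
  have hc : Coalgebra.comul (R := ℂ) (y * (z * x)) = ∑ a ∈ Y.index, ∑ c ∈ Z.index,
      ∑ b ∈ X.index, (Y.left a * (Z.left c * X.left b)) ⊗ₜ[ℂ]
        (Y.right a * (Z.right c * X.right b)) := by
    rw [Bialgebra.comul_mul, Bialgebra.comul_mul, ← Y.eq, ← Z.eq, ← X.eq]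
    simp only [Finset.sum_mul, Finset.mul_sum, Algebra.TensorProduct.tmul_mul_tmul]
    rw [Finset.sum_comm]
    refine (Finset.sum_congr rfl fun c _ => Finset.sum_comm).trans Finset.sum_comm
  rw [translate_apply, LinearMap.convMul_apply, hc]
  simp only [map_sum, TensorProduct.map_tmul, LinearMap.mul'_apply, WithConv.ofConv_sum,
    LinearMap.sum_apply, Z.convMul_apply, translate_apply]
  exact Finset.sum_congr rfl fun a _ => Finset.sum_comm

theorem translate_one (y x : Uq q) :
    translate y x (1 : FullDual q) =
      (Coalgebra.counit (R := ℂ) y * Coalgebra.counit (R := ℂ) x) • (1 : FullDual q) := by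
  ext z
  simp only [translate_apply, LinearMap.convOne_apply, Bialgebra.counit_mul,
    WithConv.ofConv_smul, LinearMap.smul_apply, smul_eq_mul, Algebra.algebraMap_self,
    RingHom.id_apply]
  ring

theorem translate_mem {s : FullDual q} (hs : s ∈ coordAlgebra q) :
    ∀ y x : Uq q, translate y x s ∈ coordAlgebra q := by
  refine Algebra.adjoin_induction (p := fun s _ => ∀ y x, translate y x s ∈ coordAlgebra q)
    ?_ ?_ ?_ ?_ hs
  · rintro _ ⟨N, i, j, rfl⟩ y x
    rw [translate_matrixElement]
    exact Subalgebra.sum_mem _ fun a _ => Subalgebra.sum_mem _ fun b _ =>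
      Subalgebra.smul_mem _ (t q N a b).2 _
  · intro c y x
    rw [Algebra.algebraMap_eq_smul_one, map_smul, translate_one]
    exact Subalgebra.smul_mem _ (Subalgebra.smul_mem _ (Subalgebra.one_mem _) _) _
  · intro r s _ _ hr hs y x
    rw [map_add]
    exact Subalgebra.add_mem _ (hr y x) (hs y x)
  · intro r s _ _ hr hs y x
    rw [translate_mul y x (Coalgebra.Repr.arbitrary ℂ y) (Coalgebra.Repr.arbitrary ℂ x)]
    exact Subalgebra.sum_mem _ fun a _ => Subalgebra.sum_mem _ fun b _ =>
      Subalgebra.mul_mem _ (hr _ _) (hs _ _)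

/-- The two-sided translate `z ↦ s (y z x)` on `ℂ[SU_{2,q}]`. -/
def coordTranslate (y x : Uq q) : CSU2 q →ₗ[ℂ] CSU2 q where
  toFun s := ⟨translate y x s.1, translate_mem s.2 y x⟩
  map_add' _ _ := Subtype.ext (map_add _ _ _)
  map_smul' _ _ := Subtype.ext (map_smul _ _ _)

variable (q)

/-- The right regular representation `∂` of `U_q(su₂)` on `ℂ[SU_{2,q}]`:
`(∂(x) s)(y) = s (y x)`. On matrix elements it is
`∂(x) (u*_{λ,m} ⊗ u_{λ,n}) = u*_{λ,m} ⊗ ϱ_λ(x) u_{λ,n}`, see `rightRegular_t`. -/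
def rightRegular : Uq q →ₐ[ℂ] Module.End ℂ (CSU2 q) where
  toFun x := coordTranslate 1 x
  map_one' := by ext s z; simp [coordTranslate, translate]
  map_mul' x y := by ext s z; simp [coordTranslate, translate, mul_assoc]
  map_zero' := by ext s z; simp [coordTranslate, translate]
  map_add' x y := by ext s z; simp [coordTranslate, translate, mul_add]
  commutes' c := by
    ext s z
    simp [coordTranslate, translate, Algebra.algebraMap_eq_smul_one]

theorem rightRegular_apply (x y : Uq q) (s : CSU2 q) :
    (rightRegular q x s : FullDual q) y = (s : FullDual q) (y * x) := by
  simp [rightRegular, coordTranslate, translate]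

theorem rightRegular_t (x : Uq q) (N : ℕ) (i j : Fin (N + 1)) :
    rightRegular q x (t q N i j) = ∑ p, rep q N x p j • t q N i p := by
  apply Subtype.ext
  ext y
  rw [rightRegular_apply]
  simp [t, matrixElement, Matrix.mul_apply, mul_comm]

/-! ### The coaction of `B = ℂ[u, u⁻¹]` on `ℂ[SU_{2,q}]` -/

section Coaction

variable {q}

theorem comul_kUnit_zpow (n : ℤ) :
    Uq.comulHom q ((Uq.kUnit q ^ n : (Uq q)ˣ) : Uq q) =
      ((Uq.kUnit q ^ n : (Uq q)ˣ) : Uq q) ⊗ₜ ((Uq.kUnit q ^ n : (Uq q)ˣ) : Uq q) := by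
  have hk : ((Uq.kUnit q : (Uq q)ˣ) : Uq q) = Uq.k q := rfl
  have hl : (((Uq.kUnit q)⁻¹ : (Uq q)ˣ) : Uq q) = Uq.kInv q := rfl
  induction n using Int.induction_on with
  | zero => simp [Algebra.TensorProduct.one_def]
  | succ n ih =>
    rw [zpow_add_one, Units.val_mul, map_mul, ih, hk, Uq.comulHom_k,
      Algebra.TensorProduct.tmul_mul_tmul]
  | pred n ih =>
    rw [zpow_sub_one, Units.val_mul, map_mul, ih, hl, Uq.comulHom_kInv,
      Algebra.TensorProduct.tmul_mul_tmul]

theorem counit_kUnit_zpow (n : ℤ) :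
    Uq.counitHom q ((Uq.kUnit q ^ n : (Uq q)ˣ) : Uq q) = 1 := by
  have hk : ((Uq.kUnit q : (Uq q)ˣ) : Uq q) = Uq.k q := rfl
  have hl : (((Uq.kUnit q)⁻¹ : (Uq q)ˣ) : Uq q) = Uq.kInv q := rfl
  induction n using Int.induction_on with
  | zero => simp
  | succ n ih => rw [zpow_add_one, Units.val_mul, map_mul, ih, hk, Uq.counitHom_k, one_mul]
  | pred n ih => rw [zpow_sub_one, Units.val_mul, map_mul, ih, hl, Uq.counitHom_kInv, one_mul]

theorem rep_kUnit_zpow (N : ℕ) (n : ℤ) :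
    rep q N ((Uq.kUnit q ^ n : (Uq q)ˣ) : Uq q) =
      Matrix.diagonal fun j => (((q : ℝ) ^ (n * wt N j) : ℝ) : ℂ) := by
  have hk : ((Uq.kUnit q : (Uq q)ˣ) : Uq q) = Uq.k q := rfl
  have hl : (((Uq.kUnit q)⁻¹ : (Uq q)ˣ) : Uq q) = Uq.kInv q := rfl
  induction n using Int.induction_on with
  | zero => simp
  | succ n ih =>
    rw [zpow_add_one, Units.val_mul, map_mul, ih, hk, rep_k, matK, Matrix.diagonal_mul_diagonal]
    congr 1; funext j
    rw [← Complex.ofReal_mul, ← Real.rpow_add q.2.1]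
    congr 2; push_cast; ring
  | pred n ih =>
    rw [zpow_sub_one, Units.val_mul, map_mul, ih, hl, rep_kInv, matKInv,
      Matrix.diagonal_mul_diagonal]
    congr 1; funext j
    rw [← Complex.ofReal_mul, ← Real.rpow_add q.2.1]
    congr 2; push_cast; ring

variable (q) (k l : ℕ)

/-- The operator `s ↦ (z ↦ s (k^{l-k} z k^{-k-l}))` on `ℂ[SU_{2,q}]`, where the base `k` is the
generator of `U_q(su₂)` and the exponents are formed from the given integers. It multiplies
`t^λ_{mn}` by `q ^ (-(m + n) k + (m - n) l)`. -/
def degreeOp : Module.End ℂ (CSU2 q) :=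
  coordTranslate ((Uq.kUnit q ^ ((l : ℤ) - k) : (Uq q)ˣ) : Uq q)
    ((Uq.kUnit q ^ (-(k : ℤ) - l) : (Uq q)ˣ) : Uq q)

/-- The homogeneous elements of order `d` in `ℂ[SU_{2,q}]`. -/
def homogeneous (d : ℤ) : Submodule ℂ (CSU2 q) :=
  Module.End.eigenspace (R := ℂ) (M := CSU2 q) (degreeOp q k l) (((q : ℝ) : ℂ) ^ d)

theorem degreeOp_mul (r s : CSU2 q) :
    degreeOp q k l (r * s) = degreeOp q k l r * degreeOp q k l s := by
  apply Subtype.ext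
  have h := fun n : ℤ => comul_kUnit_zpow (q := q) n
  let Y : ∀ n : ℤ, Coalgebra.Repr ℂ ((Uq.kUnit q ^ n : (Uq q)ˣ) : Uq q) Unit := fun n =>
    { index := {()}
      left := fun _ => ((Uq.kUnit q ^ n : (Uq q)ˣ) : Uq q)
      right := fun _ => ((Uq.kUnit q ^ n : (Uq q)ˣ) : Uq q)
      eq := by rw [Finset.sum_singleton]; exact (h n).symm }
  have := translate_mul _ _ (Y ((l : ℤ) - k)) (Y (-(k : ℤ) - l)) r.1 s.1
  simp only [Y, Finset.sum_singleton] at this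
  exact this

theorem degreeOp_one : degreeOp q k l 1 = 1 := by
  apply Subtype.ext
  refine (translate_one _ _).trans ?_
  rw [Uq.counit_eq, Uq.counit_eq, counit_kUnit_zpow, counit_kUnit_zpow, one_mul, one_smul]
  rfl

theorem t_mem_homogeneous (N : ℕ) (i j : Fin (N + 1)) :
    t q N i j ∈ homogeneous q k l
      (-((i : ℤ) + j - N) * k + ((i : ℤ) - j) * l) := by
  rw [homogeneous, Module.End.mem_eigenspace_iff]
  apply Subtype.ext
  refine (translate_matrixElement _ _ N i j).trans ?_
  rw [rep_kUnit_zpow, rep_kUnit_zpow, Finset.sum_eq_single i, Finset.sum_eq_single j]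
  · simp only [Matrix.diagonal_apply_eq]
    rw [← Complex.ofReal_mul, ← Real.rpow_add q.2.1, ← Complex.ofReal_zpow, ← Real.rpow_intCast]
    have : ((((l : ℤ) - k : ℤ) : ℝ) * wt N i + ((-(k : ℤ) - l : ℤ) : ℝ) * wt N j) =
        ((-((i : ℤ) + j - N) * k + ((i : ℤ) - j) * l : ℤ) : ℝ) := by
      simp only [wt]; push_cast; ring
    rw [this]
    rfl
  · intro b _ hb
    rw [Matrix.diagonal_apply_ne _ hb, mul_zero, zero_smul]
  · simp
  · intro a _ ha
    refine Finset.sum_eq_zero fun b _ => ?_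
    rw [Matrix.diagonal_apply_ne _ ha.symm, zero_mul, zero_smul]
  · simp

instance gradedMonoid : SetLike.GradedMonoid (homogeneous q k l) where
  one_mem := by
    rw [homogeneous, Module.End.mem_eigenspace_iff, degreeOp_one, zpow_zero, one_smul]
  mul_mem := by
    intro i j r s hr hs
    rw [homogeneous, Module.End.mem_eigenspace_iff] at hr hs ⊢
    rw [degreeOp_mul, hr, hs, smul_mul_smul_comm, zpow_add₀ (Uq.q_ne_zero q)]

theorem iSupIndep_homogeneous : iSupIndep (homogeneous q k l) := by
  refine (Module.End.eigenspaces_iSupIndep (R := ℂ) (M := CSU2 q) (degreeOp q k l)).comp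
    (f := fun d : ℤ => ((q : ℝ) : ℂ) ^ d) ?_
  intro a b h
  have h' : (q : ℝ) ^ a = (q : ℝ) ^ b := by
    have h : ((q : ℝ) : ℂ) ^ a = ((q : ℝ) : ℂ) ^ b := h
    exact_mod_cast h
  exact zpow_right_injective₀ q.2.1 q.2.2.ne h'

theorem iSup_homogeneous : iSup (homogeneous q k l) = ⊤ := by
  rw [eq_top_iff]
  rintro ⟨s, hs⟩ -
  have hmul : ∀ r s : CSU2 q, r ∈ iSup (homogeneous q k l) → s ∈ iSup (homogeneous q k l) →
      r * s ∈ iSup (homogeneous q k l) := by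
    intro r s hr hs
    induction hr using Submodule.iSup_induction' with
    | mem i r hr =>
      induction hs using Submodule.iSup_induction' with
      | mem j s hs => exact Submodule.mem_iSup_of_mem (i + j) (SetLike.mul_mem_graded hr hs)
      | zero => rw [mul_zero]; exact Submodule.zero_mem _
      | add x y _ _ hx hy => rw [mul_add]; exact Submodule.add_mem _ hx hy
    | zero => rw [zero_mul]; exact Submodule.zero_mem _
    | add x y _ _ hx hy => rw [add_mul]; exact Submodule.add_mem _ hx hy
  let G : Subalgebra ℂ (CSU2 q) := (iSup (homogeneous q k l)).toSubalgebra
    (Submodule.mem_iSup_of_mem 0 SetLike.GradedOne.one_mem) hmul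
  have hG : coordAlgebra q ≤ G.map (coordAlgebra q).val := by
    refine Algebra.adjoin_le ?_
    rintro _ ⟨N, i, j, rfl⟩
    exact ⟨t q N i j, Submodule.mem_iSup_of_mem _ (t_mem_homogeneous q k l N i j), rfl⟩
  obtain ⟨g, hg, hgs⟩ := hG hs
  have : g = ⟨s, hs⟩ := Subtype.ext hgs
  exact this ▸ hg

theorem isInternal_homogeneous : DirectSum.IsInternal (homogeneous q k l) :=
  DirectSum.isInternal_submodule_of_iSupIndep_of_iSup_eq_top (R := ℂ) (M := CSU2 q)
    (iSupIndep_homogeneous q k l) (iSup_homogeneous q k l)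

/-- The decomposition of `ℂ[SU_{2,q}]` into its homogeneous components, as a graded algebra. -/
instance gradedAlgebra : GradedAlgebra (homogeneous q k l) where
  toGradedMonoid := gradedMonoid q k l
  toDecomposition := (isInternal_homogeneous q k l).chooseDecomposition

/-- The coaction `θ : ℂ[SU_{2,q}] → ℂ[SU_{2,q}] ⊗ B`, `B = ℂ[u, u⁻¹]`: the algebra homomorphism
with `α ↦ α ⊗ u^{-k}`, `β ↦ β ⊗ u^l`, `α* ↦ α* ⊗ u^k`, `β* ↦ β* ⊗ u^{-l}` (see `coordCoaction_α`
and the lemmas below it). It sends a homogeneous `s` of order `d` to `s ⊗ u^d`. -/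
def coordCoaction : CSU2 q →ₐ[ℂ] CSU2 q ⊗[ℂ] ℂ[T;T⁻¹] :=
  (DirectSum.toAlgebra ℂ (fun d => homogeneous q k l d)
    (fun d => (TensorProduct.mk ℂ (CSU2 q) ℂ[T;T⁻¹]).flip (LaurentPolynomial.T d) ∘ₗ
      (homogeneous q k l d).subtype)
    (by simp [Algebra.TensorProduct.one_def])
    (by
      intro i j r s
      change ((r : CSU2 q) * (s : CSU2 q)) ⊗ₜ[ℂ] LaurentPolynomial.T (i + j) =
        ((r : CSU2 q) ⊗ₜ[ℂ] LaurentPolynomial.T i) * ((s : CSU2 q) ⊗ₜ[ℂ] LaurentPolynomial.T j)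
      rw [Algebra.TensorProduct.tmul_mul_tmul, LaurentPolynomial.T_add])).comp
    (DirectSum.decomposeAlgEquiv (homogeneous q k l)).toAlgHom

theorem coordCoaction_of_mem {d : ℤ} {s : CSU2 q} (hs : s ∈ homogeneous q k l d) :
    coordCoaction q k l s = s ⊗ₜ LaurentPolynomial.T d := by
  have h : DirectSum.decomposeAlgEquiv (homogeneous q k l) s =
      DirectSum.of (fun i => homogeneous q k l i) d ⟨s, hs⟩ := DirectSum.decompose_of_mem _ hs
  rw [coordCoaction, AlgHom.comp_apply]
  erw [h]
  exact DirectSum.toAddMonoid_of (fun d => ((TensorProduct.mk ℂ (CSU2 q) ℂ[T;T⁻¹]).flip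
    (LaurentPolynomial.T d) ∘ₗ (homogeneous q k l d).subtype).toAddMonoidHom) d ⟨s, hs⟩

theorem coordCoaction_t (N : ℕ) (i j : Fin (N + 1)) :
    coordCoaction q k l (t q N i j) =
      t q N i j ⊗ₜ LaurentPolynomial.T (-((i : ℤ) + j - N) * k + ((i : ℤ) - j) * l) :=
  coordCoaction_of_mem q k l (t_mem_homogeneous q k l N i j)

theorem coordCoaction_α :
    coordCoaction q k l (α q) = α q ⊗ₜ LaurentPolynomial.T (-(k : ℤ)) := by
  have h := coordCoaction_t q k l 1 1 1
  simp at h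
  exact h

theorem coordCoaction_β :
    coordCoaction q k l (β q) = β q ⊗ₜ LaurentPolynomial.T (l : ℤ) := by
  have h := coordCoaction_t q k l 1 1 0
  simp at h
  exact h

theorem coordCoaction_αStar :
    coordCoaction q k l (αStar q) = αStar q ⊗ₜ LaurentPolynomial.T (k : ℤ) := by
  have h := coordCoaction_t q k l 1 0 0
  simp at h
  exact h

theorem coordCoaction_βStar :
    coordCoaction q k l (βStar q) = βStar q ⊗ₜ LaurentPolynomial.T (-(l : ℤ)) := by
  have h : coordCoaction q k l (t q 1 0 1) =
      t q 1 0 1 ⊗ₜ LaurentPolynomial.T (-(l : ℤ)) := by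
    simpa using coordCoaction_t q k l 1 0 1
  rw [βStar, map_smul, h, TensorProduct.smul_tmul']

end Coaction

end Coord

/-! ### Coactions and equivariance -/

/-- A (right) coaction of the Hopf algebra `B = ℂ[u, u⁻¹]` on a vector space `V`: a linear map
`δ : V → V ⊗ B` with `(δ ⊗ id) δ = (id ⊗ Δ) δ` and `(id ⊗ ε) δ = id`. -/
structure IsCoaction {V : Type*} [AddCommGroup V] [Module ℂ V]
    (δ : V →ₗ[ℂ] V ⊗[ℂ] ℂ[T;T⁻¹]) : Prop where
  coassoc : (TensorProduct.assoc ℂ V ℂ[T;T⁻¹] ℂ[T;T⁻¹]).toLinearMap ∘ₗ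
    δ.rTensor ℂ[T;T⁻¹] ∘ₗ δ = (Coalgebra.comul (R := ℂ) (A := ℂ[T;T⁻¹])).lTensor V ∘ₗ δ
  counit : (TensorProduct.rid ℂ V).toLinearMap ∘ₗ
    (Coalgebra.counit (R := ℂ) (A := ℂ[T;T⁻¹])).lTensor V ∘ₗ δ = LinearMap.id

/-- The bilinear action `((∂ ⊗ ι)(x ⊗ b)) (s ⊗ c) = ∂(x) s ⊗ b c` of `U_q(su₂) ⊗ B` on
`ℂ[SU_{2,q}] ⊗ B`. -/
def actB (q : Set.Ioo (0 : ℝ) 1) : Uq q ⊗[ℂ] ℂ[T;T⁻¹] →ₗ[ℂ]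
    CSU2 q ⊗[ℂ] ℂ[T;T⁻¹] →ₗ[ℂ] CSU2 q ⊗[ℂ] ℂ[T;T⁻¹] :=
  TensorProduct.map₂ (rightRegular q).toLinearMap (LinearMap.mul ℂ ℂ[T;T⁻¹])

/-- Right equivariance of a linear map `θ : U_q(su₂) → U_q(su₂) ⊗ B`:
`θ(∂(x) s) = (∂ ⊗ ι)(θ(x)) (θ(s))` for all `x ∈ U_q(su₂)` and `s ∈ ℂ[SU_{2,q}]`, where on
`ℂ[SU_{2,q}]` the symbol `θ` denotes `coordCoaction q k l`. -/
def IsRightEquivariant (q : Set.Ioo (0 : ℝ) 1) (k l : ℕ)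
    (θ : Uq q →ₗ[ℂ] Uq q ⊗[ℂ] ℂ[T;T⁻¹]) : Prop :=
  ∀ (x : Uq q) (s : CSU2 q),
    coordCoaction q k l (rightRegular q x s) = actB q (θ x) (coordCoaction q k l s)

end QuantumSU2

end

/-!
Existence. The assignment `e ↦ e ⊗ u^{-k-l}`, `f ↦ f ⊗ u^{k+l}`, `k^{±1} ↦ k^{±1} ⊗ 1` respects the
defining relations, so it extends to an algebra homomorphism (`uqCoaction`). The coaction axioms
are identities between algebra homomorphisms and hold on the generators. Equivariance is
multiplicative in `x`, so it also suffices to check it for the generators, and only against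
homogeneous `s ∈ ℂ[SU_{2,q}]`, since these span. The degree of `s` is read off from a two-sided
translation by powers of `k`, and `e`, `f`, `k` are eigenvectors of conjugation by powers of `k`;
hence `∂(e)`, `∂(f)`, `∂(k)` shift the degree by `-k-l`, `k+l`, `0`
(`rightRegular_mem_homogeneous`).

Uniqueness. Writing `θ(x) = ∑ xₙ ⊗ uⁿ`, equivariance against a homogeneous `s` of degree `d`
determines the coefficient `∂(xₙ) s` of `u^{n+d}`. Homogeneous elements span, so the operator
`∂(xₙ)` is determined, and it remains to see that `∂` is faithful. This reduces to the fact that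
the representations `ϱ_λ` have zero common kernel (`eq_zero_of_rep_eq_zero`). For that, write an
element as a combination of the monomials `f^a k^n e^b`, take the smallest `b` that occurs, and
look at the matrix entry from `u_{λ, λ-b}` to `u_{λ, λ-a}`: only the monomials with this `a` and
`b` contribute, and what remains is a power sum `∑ cₙ (q^{n/2})^{2λ}` that vanishes for all large
`λ`, so that `cₙ = 0` by the linear independence of characters.
-/

noncomputable section
namespace QuantumSU2

/-! ### The coaction on `U_q(su₂)` -/

section Existence

variable (q : Set.Ioo (0 : ℝ) 1)

/-- The coaction of `ℂ[u, u⁻¹]` on `U_q(su₂)` for which `e`, `f`, `k` are homogeneous of degrees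
`-d`, `d`, `0`, as an algebra homomorphism. -/
def uqCoaction (d : ℤ) : Uq q →ₐ[ℂ] Uq q ⊗[ℂ] ℂ[T;T⁻¹] :=
  Uq.lift (A := Uq q ⊗[ℂ] ℂ[T;T⁻¹]) (Uq.e q ⊗ₜ[ℂ] LaurentPolynomial.T (-d)) (Uq.f q ⊗ₜ[ℂ] LaurentPolynomial.T d)
    (Uq.k q ⊗ₜ[ℂ] 1) (Uq.kInv q ⊗ₜ[ℂ] 1)
    (by
      simp only [Algebra.TensorProduct.tmul_mul_tmul, one_mul, mul_one, Uq.k_mul_e,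
        TensorProduct.smul_tmul'])
    (by
      simp only [Algebra.TensorProduct.tmul_mul_tmul, one_mul, mul_one, Uq.k_mul_f,
        TensorProduct.smul_tmul'])
    (by
      simp only [pow_two, Algebra.TensorProduct.tmul_mul_tmul, one_mul, ← LaurentPolynomial.T_add,
        neg_add_cancel, add_neg_cancel, LaurentPolynomial.T_zero, ← TensorProduct.sub_tmul,
        Uq.e_mul_f_sub, TensorProduct.smul_tmul'])
    (by rw [Algebra.TensorProduct.tmul_mul_tmul, Uq.k_mul_kInv, one_mul]; rfl)
    (by rw [Algebra.TensorProduct.tmul_mul_tmul, Uq.kInv_mul_k, one_mul]; rfl)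

variable (d : ℤ)

@[simp] theorem uqCoaction_e :
    uqCoaction q d (Uq.e q) = Uq.e q ⊗ₜ LaurentPolynomial.T (-d) := Uq.lift_e ..
@[simp] theorem uqCoaction_f :
    uqCoaction q d (Uq.f q) = Uq.f q ⊗ₜ LaurentPolynomial.T d := Uq.lift_f ..
@[simp] theorem uqCoaction_k : uqCoaction q d (Uq.k q) = Uq.k q ⊗ₜ 1 := Uq.lift_k ..
@[simp] theorem uqCoaction_kInv : uqCoaction q d (Uq.kInv q) = Uq.kInv q ⊗ₜ 1 := Uq.lift_kInv ..

theorem isCoaction_uqCoaction : IsCoaction (uqCoaction q d).toLinearMap where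
  coassoc := by
    -- Both sides are algebra homomorphisms, so they may be compared on the generators.
    have h : ((Algebra.TensorProduct.assoc ℂ ℂ ℂ (Uq q) ℂ[T;T⁻¹] ℂ[T;T⁻¹]).toAlgHom.comp
        (Algebra.TensorProduct.map (uqCoaction q d) (AlgHom.id ℂ ℂ[T;T⁻¹]))).comp
          (uqCoaction q d) =
        (Algebra.TensorProduct.map (AlgHom.id ℂ (Uq q)) (Bialgebra.comulAlgHom ℂ ℂ[T;T⁻¹])).comp
          (uqCoaction q d) := by
      apply Uq.algHom_ext <;> simp [Algebra.TensorProduct.one_def]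
    exact congrArg AlgHom.toLinearMap h
  counit := by
    have h : ((Algebra.TensorProduct.rid ℂ ℂ (Uq q)).toAlgHom.comp
        (Algebra.TensorProduct.map (AlgHom.id ℂ (Uq q)) (Bialgebra.counitAlgHom ℂ ℂ[T;T⁻¹]))).comp
          (uqCoaction q d) = AlgHom.id ℂ (Uq q) := by
      apply Uq.algHom_ext <;> simp
    exact congrArg AlgHom.toLinearMap h

variable {q}

theorem actB_tmul (x : Uq q) (b c : ℂ[T;T⁻¹]) (s : CSU2 q) :
    actB q (x ⊗ₜ b) (s ⊗ₜ c) = rightRegular q x s ⊗ₜ (b * c) := rfl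

theorem actB_one (v : CSU2 q ⊗[ℂ] ℂ[T;T⁻¹]) : actB q 1 v = v := by
  induction v with
  | zero => simp
  | tmul s c => rw [Algebra.TensorProduct.one_def, actB_tmul, map_one, one_mul]; rfl
  | add v w hv hw => rw [map_add, hv, hw]

theorem actB_mul (y z : Uq q ⊗[ℂ] ℂ[T;T⁻¹]) (v : CSU2 q ⊗[ℂ] ℂ[T;T⁻¹]) :
    actB q (y * z) v = actB q y (actB q z v) := by
  induction y with
  | zero => simp
  | add y₁ y₂ h₁ h₂ => rw [add_mul, map_add, LinearMap.add_apply, h₁, h₂, map_add,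
      LinearMap.add_apply]
  | tmul x b =>
    induction z with
    | zero => simp
    | add z₁ z₂ h₁ h₂ => rw [mul_add, map_add, LinearMap.add_apply, h₁, h₂, map_add,
        LinearMap.add_apply, map_add]
    | tmul y c =>
      induction v with
      | zero => simp
      | add v w hv hw => rw [map_add, hv, hw, map_add, map_add]
      | tmul s a =>
        rw [Algebra.TensorProduct.tmul_mul_tmul, actB_tmul, actB_tmul, actB_tmul, map_mul,
          mul_assoc]
        rfl

/-- If `x` is a weight vector for conjugation by `k`, then `∂(x)` shifts the degree of
homogeneous elements accordingly. -/
theorem rightRegular_mem_homogeneous (k l : ℕ) {d n : ℤ} {x : Uq q} {s : CSU2 q}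
    (hx : ((Uq.kUnit q ^ (-(k : ℤ) - l) : (Uq q)ˣ) : Uq q) * x =
      ((q : ℝ) : ℂ) ^ n • (x * ((Uq.kUnit q ^ (-(k : ℤ) - l) : (Uq q)ˣ) : Uq q)))
    (hs : s ∈ homogeneous q k l d) : rightRegular q x s ∈ homogeneous q k l (d + n) := by
  rw [homogeneous, Module.End.mem_eigenspace_iff] at hs ⊢
  apply Subtype.ext
  ext z
  have h := congrArg (fun r : CSU2 q => (r : FullDual q) (z * x)) hs
  change (s : FullDual q) (_ * ((z * x) * _)) = (((q : ℝ) : ℂ) ^ d) • (s : FullDual q) (z * x) at h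
  change (rightRegular q x s : FullDual q) (_ * (z * _)) =
    (((q : ℝ) : ℂ) ^ (d + n)) • (rightRegular q x s : FullDual q) z
  have hsmul : ∀ (c : ℂ) (w : Uq q), (s : FullDual q) (c • w) = c • (s : FullDual q) w :=
    fun c w => LinearMap.map_smul s.1.ofConv c w
  rw [rightRegular_apply, rightRegular_apply, mul_assoc, mul_assoc, hx, mul_smul_comm,
    mul_smul_comm, hsmul, ← mul_assoc z, h, smul_smul, zpow_add₀ (Uq.q_ne_zero q), mul_comm]

theorem kUnit_zpow_mul {x : Uq q} {c : ℂ} (hc : c ≠ 0) (h : Uq.k q * x = c • (x * Uq.k q))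
    (n : ℤ) : ((Uq.kUnit q ^ n : (Uq q)ˣ) : Uq q) * x =
      c ^ n • (x * ((Uq.kUnit q ^ n : (Uq q)ˣ) : Uq q)) := by
  have hinv : Uq.kInv q * x = c⁻¹ • (x * Uq.kInv q) := by
    calc Uq.kInv q * x = Uq.kInv q * (c⁻¹ • c • (x * Uq.k q)) * Uq.kInv q := by
          rw [smul_smul, inv_mul_cancel₀ hc, one_smul, mul_assoc, mul_assoc, Uq.k_mul_kInv,
            mul_one]
      _ = c⁻¹ • (x * Uq.kInv q) := by
          rw [← h, mul_smul_comm, smul_mul_assoc, ← mul_assoc, Uq.kInv_mul_k, one_mul]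
  have hk : ((Uq.kUnit q : (Uq q)ˣ) : Uq q) = Uq.k q := rfl
  have hl : (((Uq.kUnit q)⁻¹ : (Uq q)ˣ) : Uq q) = Uq.kInv q := rfl
  induction n using Int.induction_on with
  | zero => simp
  | succ n ih =>
    rw [zpow_add_one, Units.val_mul, mul_assoc, hk, h, mul_smul_comm, ← mul_assoc, ih,
      smul_mul_assoc, smul_smul, mul_assoc, zpow_add_one₀ hc, mul_comm c]
  | pred n ih =>
    rw [zpow_sub_one, Units.val_mul, mul_assoc, hl, hinv, mul_smul_comm, ← mul_assoc, ih,
      smul_mul_assoc, smul_smul, mul_assoc, zpow_sub_one₀ hc, mul_comm c⁻¹]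

theorem kUnit_zpow_mul_e (n : ℤ) : ((Uq.kUnit q ^ n : (Uq q)ˣ) : Uq q) * Uq.e q =
    ((q : ℝ) : ℂ) ^ n • (Uq.e q * ((Uq.kUnit q ^ n : (Uq q)ˣ) : Uq q)) :=
  kUnit_zpow_mul (Uq.q_ne_zero q) (Uq.k_mul_e q) n

theorem kUnit_zpow_mul_f (n : ℤ) : ((Uq.kUnit q ^ n : (Uq q)ˣ) : Uq q) * Uq.f q =
    ((q : ℝ) : ℂ) ^ (-n) • (Uq.f q * ((Uq.kUnit q ^ n : (Uq q)ˣ) : Uq q)) := by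
  rw [kUnit_zpow_mul (inv_ne_zero (Uq.q_ne_zero q)) (Uq.k_mul_f q) n, inv_zpow']

/-- A subspace that contains `1` and is stable under left multiplication by the generators is all
of `U_q(su₂)`. -/
theorem mem_of_generators (S : Submodule ℂ (Uq q)) (h1 : (1 : Uq q) ∈ S)
    (he : ∀ x ∈ S, Uq.e q * x ∈ S) (hf : ∀ x ∈ S, Uq.f q * x ∈ S)
    (hk : ∀ x ∈ S, Uq.k q * x ∈ S) (hl : ∀ x ∈ S, Uq.kInv q * x ∈ S) (x : Uq q) : x ∈ S := by
  suffices H : ∀ a : FreeAlgebra ℂ Gen, ∀ y ∈ S, RingQuot.mkAlgHom ℂ (Rel q) a * y ∈ S by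
    obtain ⟨a, rfl⟩ := RingQuot.mkAlgHom_surjective ℂ (Rel q) x
    simpa using H a 1 h1
  intro a
  induction a using FreeAlgebra.induction with
  | grade0 c =>
    intro y hy
    rw [AlgHom.commutes, ← Algebra.smul_def]
    exact S.smul_mem c hy
  | grade1 g => cases g <;> assumption
  | mul a b ha hb => intro y hy; rw [map_mul, mul_assoc]; exact ha _ (hb _ hy)
  | add a b ha hb => intro y hy; rw [map_add, add_mul]; exact S.add_mem (ha _ hy) (hb _ hy)

theorem isRightEquivariant_uqCoaction (k l : ℕ) :
    IsRightEquivariant q k l (uqCoaction q ((k : ℤ) + l)).toLinearMap := by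
  -- Equivariance at a weight vector `x` is checked on homogeneous elements, which span.
  have key : ∀ (x : Uq q) (n : ℤ), uqCoaction q ((k : ℤ) + l) x = x ⊗ₜ LaurentPolynomial.T n →
      ((Uq.kUnit q ^ (-(k : ℤ) - l) : (Uq q)ˣ) : Uq q) * x =
        ((q : ℝ) : ℂ) ^ n • (x * ((Uq.kUnit q ^ (-(k : ℤ) - l) : (Uq q)ˣ) : Uq q)) →
      ∀ s : CSU2 q, coordCoaction q k l (rightRegular q x s) =
        actB q (uqCoaction q ((k : ℤ) + l) x) (coordCoaction q k l s) := by
    intro x n hx hxn s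
    have hs : s ∈ iSup (homogeneous q k l) := by rw [iSup_homogeneous]; trivial
    induction hs using Submodule.iSup_induction' with
    | mem d s hs =>
      rw [coordCoaction_of_mem q k l (rightRegular_mem_homogeneous k l hxn hs),
        coordCoaction_of_mem q k l hs, hx, actB_tmul, ← LaurentPolynomial.T_add, add_comm]
    | zero => simp
    | add s r _ _ hs hr => rw [map_add, map_add, hs, hr, map_add, map_add]
  have hkk : ((Uq.kUnit q : (Uq q)ˣ) : Uq q) = Uq.k q := rfl
  have hll : (((Uq.kUnit q)⁻¹ : (Uq q)ˣ) : Uq q) = Uq.kInv q := rfl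
  let S : Submodule ℂ (Uq q) :=
    { carrier := {x | ∀ s : CSU2 q, coordCoaction q k l (rightRegular q x s) =
        actB q (uqCoaction q ((k : ℤ) + l) x) (coordCoaction q k l s)}
      zero_mem' := fun s => by simp
      add_mem' := fun {x y} hx hy s => by
        simp only [map_add, LinearMap.add_apply, hx s, hy s]
      smul_mem' := fun c x hx s => by
        simp only [map_smul, LinearMap.smul_apply, hx s] }
  have hmul : ∀ x ∈ S, ∀ y ∈ S, x * y ∈ S := fun x hx y hy s => by
    rw [map_mul, map_mul, actB_mul, ← hy s]
    exact hx (rightRegular q y s)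
  refine mem_of_generators S ?_ (hmul _ (key _ _ (uqCoaction_e q _) ?_))
    (hmul _ (key _ _ (uqCoaction_f q _) ?_)) (hmul _ (key _ 0 (uqCoaction_k q _) ?_))
    (hmul _ (key _ 0 (uqCoaction_kInv q _) ?_))
  · intro s
    rw [map_one, map_one, actB_one]; rfl
  · rw [kUnit_zpow_mul_e, neg_add']
  · rw [kUnit_zpow_mul_f, neg_sub', neg_neg, sub_neg_eq_add]
  · rw [zpow_zero, one_smul, ← hkk, ← Units.val_mul, ← Units.val_mul, mul_zpow_self,
      mul_self_zpow, add_comm]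
  · rw [zpow_zero, one_smul, ← hll, ← Units.val_mul, ← Units.val_mul,
      ((Commute.refl (Uq.kUnit q)).zpow_left _).inv_right.eq]

end Existence
/-! ### The irreducible representations separate the points of `U_q(su₂)` -/

section Separation

variable {q : Set.Ioo (0 : ℝ) 1}

variable (q) in
/-- The ordered monomial `f ^ a k ^ n e ^ b`, with `((a, b), n)` as its index. -/
def pbwMonomial (p : (ℕ × ℕ) × ℤ) : Uq q :=
  Uq.f q ^ p.1.1 * (((Uq.kUnit q ^ p.2 : (Uq q)ˣ) : Uq q) * Uq.e q ^ p.1.2)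

/-- The spanning half of the Poincaré–Birkhoff–Witt theorem. -/
theorem span_pbwMonomial : Submodule.span ℂ (Set.range (pbwMonomial q)) = ⊤ := by
  set S := Submodule.span ℂ (Set.range (pbwMonomial q))
  have mem : ∀ (a : ℕ) (n : ℤ) (b : ℕ), Uq.f q ^ a * (((Uq.kUnit q ^ n : (Uq q)ˣ) : Uq q) * Uq.e q ^ b) ∈ S :=
    fun a n b => Submodule.subset_span ⟨((a, b), n), rfl⟩
  have stable : ∀ y : Uq q, (∀ (a : ℕ) (n : ℤ) (b : ℕ), y * (Uq.f q ^ a *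
      (((Uq.kUnit q ^ n : (Uq q)ˣ) : Uq q) * Uq.e q ^ b)) ∈ S) → ∀ x ∈ S, y * x ∈ S := by
    intro y hy x hx
    induction hx using Submodule.span_induction with
    | mem x hx => obtain ⟨⟨⟨a, b⟩, n⟩, rfl⟩ := hx; exact hy a n b
    | zero => rw [mul_zero]; exact S.zero_mem
    | add x z _ _ hx hz => rw [mul_add]; exact S.add_mem hx hz
    | smul c x _ hx => rw [mul_smul_comm]; exact S.smul_mem c hx
  have hf : ∀ x ∈ S, Uq.f q * x ∈ S := stable _ fun a n b => by
    rw [← mul_assoc, ← pow_succ']; exact mem _ _ _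
  have hk : ∀ m : ℤ, ∀ x ∈ S, ((Uq.kUnit q ^ m : (Uq q)ˣ) : Uq q) * x ∈ S := by
    intro m
    have h : ∀ (a : ℕ) (n : ℤ) (b : ℕ), ((Uq.kUnit q ^ m : (Uq q)ˣ) : Uq q) * (Uq.f q ^ a *
        (((Uq.kUnit q ^ n : (Uq q)ˣ) : Uq q) * Uq.e q ^ b)) ∈ S := by
      intro a n b
      induction a with
      | zero =>
        rw [pow_zero, one_mul, ← mul_assoc, ← Units.val_mul, ← zpow_add]
        simpa using mem 0 (m + n) b
      | succ a ih =>
        rw [pow_succ', mul_assoc, ← mul_assoc, kUnit_zpow_mul_f, smul_mul_assoc, mul_assoc]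
        exact S.smul_mem _ (hf _ ih)
    exact stable _ h
  have hk1 : ∀ x ∈ S, Uq.k q * x ∈ S := by simpa [Uq.kUnit] using hk 1
  have hl1 : ∀ x ∈ S, Uq.kInv q * x ∈ S := by simpa [Uq.kUnit] using hk (-1)
  have he : ∀ x ∈ S, Uq.e q * x ∈ S := by
    refine stable _ fun a n b => ?_
    induction a with
    | zero =>
      have h := kUnit_zpow_mul_e (q := q) n
      rw [← inv_smul_eq_iff₀ (zpow_ne_zero n (Uq.q_ne_zero q))] at h
      rw [pow_zero, one_mul, ← mul_assoc, ← h, smul_mul_assoc, mul_assoc, ← pow_succ']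
      simpa using S.smul_mem _ (mem 0 n (b + 1))
    | succ a ih =>
      rw [pow_succ', mul_assoc, ← mul_assoc, ← sub_add_cancel (Uq.e q * Uq.f q)
        (Uq.f q * Uq.e q), Uq.e_mul_f_sub, add_mul, smul_mul_assoc, sub_mul, pow_two, pow_two,
        mul_assoc, mul_assoc, mul_assoc]
      exact S.add_mem (S.smul_mem _ (S.sub_mem (hk1 _ (hk1 _ (mem _ _ _)))
        (hl1 _ (hl1 _ (mem _ _ _))))) (hf _ ih)
  rw [eq_top_iff]
  exact fun x _ => mem_of_generators S (by simpa using mem 0 0 0) he hf hk1 hl1 x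

theorem qNum_pos {x : ℝ} (hx : 0 < x) : 0 < qNum q x := by
  refine div_pos_of_neg_of_neg ?_ (q_sub_inv_neg q)
  have := Real.rpow_lt_rpow_of_exponent_gt q.2.1 q.2.2 (show -x < x by linarith)
  linarith

theorem matE_ne_zero_iff (N : ℕ) (i j : Fin (N + 1)) :
    matE q N i j ≠ 0 ↔ (i : ℕ) = j + 1 := by
  simp only [matE, Matrix.of_apply]
  split_ifs with h
  · simp only [h, iff_true]
    have hj : ((j : ℕ) : ℝ) + 1 ≤ N := by exact_mod_cast (show (j : ℕ) + 1 ≤ N by omega)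
    have h1 : 0 < (N : ℝ) / 2 - wt N j := by unfold wt; linarith
    have h2 : 0 < (N : ℝ) / 2 + wt N j + 1 := by linarith [neg_wt_le N j]
    exact_mod_cast (Real.sqrt_pos.2 (mul_pos (qNum_pos h1) (qNum_pos h2))).ne'
  · simp [h]

theorem matF_ne_zero_iff (N : ℕ) (i j : Fin (N + 1)) :
    matF q N i j ≠ 0 ↔ (i : ℕ) + 1 = j := by
  simp only [matF, Matrix.of_apply]
  split_ifs with h
  · simp only [h, iff_true]
    have hj : (1 : ℝ) ≤ ((j : ℕ) : ℝ) := by exact_mod_cast (show 1 ≤ (j : ℕ) by omega)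
    have h1 : 0 < (N : ℝ) / 2 - wt N j + 1 := by linarith [wt_le N j]
    have h2 : 0 < (N : ℝ) / 2 + wt N j := by unfold wt; linarith
    exact_mod_cast (Real.sqrt_pos.2 (mul_pos (qNum_pos h1) (qNum_pos h2))).ne'
  · simp [h]

theorem matE_pow_ne_zero_iff (N b : ℕ) (i j : Fin (N + 1)) :
    (matE q N ^ b) i j ≠ 0 ↔ (i : ℕ) = j + b := by
  induction b generalizing j with
  | zero => simp [Matrix.one_apply, Fin.ext_iff]
  | succ b ih =>
    rw [pow_succ, Matrix.mul_apply]
    by_cases hj : (j : ℕ) + 1 < N + 1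
    · rw [Finset.sum_eq_single ⟨j + 1, hj⟩, mul_ne_zero_iff, ih, matE_ne_zero_iff]
      · simp; omega
      · intro p _ hp
        rw [not_not.1 fun h => hp (Fin.ext ((matE_ne_zero_iff N p j).1 h)), mul_zero]
      · simp
    · rw [Finset.sum_eq_zero]
      · simp; omega
      · intro p _
        rw [not_not.1 fun h => hj ((matE_ne_zero_iff N p j).1 h ▸ p.2), mul_zero]

theorem matF_pow_ne_zero_iff (N a : ℕ) (i j : Fin (N + 1)) :
    (matF q N ^ a) i j ≠ 0 ↔ (i : ℕ) + a = j := by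
  induction a generalizing i with
  | zero => simp [Matrix.one_apply, Fin.ext_iff]
  | succ a ih =>
    rw [pow_succ', Matrix.mul_apply]
    by_cases hi : (i : ℕ) + 1 < N + 1
    · rw [Finset.sum_eq_single ⟨i + 1, hi⟩, mul_ne_zero_iff, ih, matF_ne_zero_iff]
      · simp; omega
      · intro p _ hp
        rw [not_not.1 fun h => hp (Fin.ext ((matF_ne_zero_iff N i p).1 h).symm), zero_mul]
      · simp
    · rw [Finset.sum_eq_zero]
      · simp; omega
      · intro p _
        rw [not_not.1 fun h => hi ((matF_ne_zero_iff N i p).1 h ▸ p.2), zero_mul]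

theorem rep_pbwMonomial (N a b : ℕ) (n : ℤ) (i j : Fin (N + 1)) :
    rep q N (pbwMonomial q ((a, b), n)) i j = ∑ p, (matF q N ^ a) i p *
      ((((q : ℝ) ^ (n * wt N p) : ℝ) : ℂ) * (matE q N ^ b) p j) := by
  simp only [pbwMonomial, map_mul, map_pow, rep_e, rep_f, rep_kUnit_zpow]
  rw [Matrix.mul_apply]
  simp only [Matrix.diagonal_mul]

/-- A power sum in the distinct bases `r ^ n`, `n ∈ ℤ`, that vanishes for all large exponents has
zero coefficients. -/
theorem eq_zero_of_eventually_sum_zpow_eq_zero {r : ℝ} (h0 : 0 < r) (h1 : r < 1) (c : ℤ →₀ ℂ)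
    (M : ℕ) (h : ∀ N ≥ M, (c.sum fun n z => z * ((r : ℂ) ^ n) ^ N) = 0) : c = 0 := by
  have hr : (r : ℂ) ≠ 0 := by exact_mod_cast h0.ne'
  -- The functions `N ↦ (r ^ n) ^ N` are distinct characters of `ℕ`.
  let χ : ℤ → (Multiplicative ℕ →* ℂ) := fun n => powersHom ℂ ((r : ℂ) ^ n)
  have hχ : Function.Injective χ := by
    intro m n h
    have h' := (powersHom ℂ).injective h
    have h'' : r ^ m = r ^ n := by exact_mod_cast h'
    exact zpow_right_injective₀ h0 h1.ne h''
  have hli := (linearIndependent_monoidHom (Multiplicative ℕ) ℂ).comp χ hχ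
  rw [linearIndependent_iff'] at hli
  ext n
  by_contra hn
  have := hli c.support (fun n => c n * ((r : ℂ) ^ n) ^ M) (by
    funext N
    have hN := h (M + N.toAdd) (Nat.le_add_right _ _)
    rw [Finsupp.sum] at hN
    rw [Finset.sum_apply]
    simpa [χ, pow_add, mul_assoc] using hN) n (Finsupp.mem_support_iff.2 hn)
  exact hn ((mul_eq_zero.1 this).resolve_right (pow_ne_zero _ (zpow_ne_zero _ hr)))

/-- The intersection of the kernels of the representations `ϱ_λ` is zero. In a combination of
ordered monomials `f ^ a k ^ n e ^ b` acting on the weight vector `u_{λ, λ - b}`, the monomials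
with a larger power of `e` vanish and the others give multiples of `f ^ a u_{λ, λ}`. -/
theorem eq_zero_of_rep_eq_zero {x : Uq q} (hx : ∀ N, rep q N x = 0) : x = 0 := by
  have hmem : x ∈ Submodule.span ℂ (Set.range (pbwMonomial q)) := by
    rw [span_pbwMonomial]; trivial
  obtain ⟨c, rfl⟩ := Finsupp.mem_span_range_iff_exists_finsupp.1 hmem
  suffices H : ∀ b a, c.curry (a, b) = 0 by
    have : c = 0 := by
      ext ⟨⟨a, b⟩, n⟩
      have := DFunLike.congr_fun (H b a) n
      simpa using this
    rw [this, Finsupp.sum_zero_index]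
  intro b
  induction b using Nat.strong_induction_on with
  | _ b ih =>
  intro a
  set r : ℝ := (q : ℝ) ^ (1 / 2 : ℝ) with hr
  refine eq_zero_of_eventually_sum_zpow_eq_zero (r := r) (Real.rpow_pos_of_pos q.2.1 _)
    (Real.rpow_lt_one q.2.1.le q.2.2 (by norm_num)) _ (a + b) fun N hN => ?_
  let i : Fin (N + 1) := ⟨N - a, by omega⟩
  let j : Fin (N + 1) := ⟨N - b, by omega⟩
  have hij := congrFun (congrFun (hx N) i) j
  rw [← Finsupp.sum_curry_index c (fun p n z => z • pbwMonomial q (p, n))] at hij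
  simp only [Finsupp.sum, map_sum, Matrix.sum_apply, map_smul, Matrix.smul_apply,
    Matrix.zero_apply] at hij
  have hoff : ∀ p : ℕ × ℕ, p ≠ (a, b) → ∑ n ∈ (c.curry p).support,
      (c.curry p) n • rep q N (pbwMonomial q (p, n)) i j = 0 := by
    rintro ⟨a', b'⟩ hp
    rcases lt_or_ge b' b with hb | hb
    · rw [ih b' hb a']; simp
    refine Finset.sum_eq_zero fun n _ => ?_
    rw [rep_pbwMonomial, Finset.sum_eq_zero, smul_zero]
    intro p _
    by_contra hne
    obtain ⟨h1, h2⟩ := mul_ne_zero_iff.1 hne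
    have h3 := (matF_pow_ne_zero_iff N a' i p).1 h1
    have h4 := (matE_pow_ne_zero_iff N b' p j).1 (mul_ne_zero_iff.1 h2).2
    have := p.2
    simp only [i, j] at h3 h4
    exact hp (Prod.ext (by simp; omega) (by simp; omega))
  have hsum : ∑ n ∈ (c.curry (a, b)).support,
      (c.curry (a, b)) n • rep q N (pbwMonomial q ((a, b), n)) i j = 0 := by
    by_cases hab : (a, b) ∈ c.curry.support
    · rwa [Finset.sum_eq_single_of_mem _ hab fun p _ hp => hoff p hp] at hij
    · rw [Finsupp.notMem_support_iff.1 hab]; simp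
  -- Through the highest weight vector, `f ^ a` and `e ^ b` contribute nonzero factors.
  have hF := (matF_pow_ne_zero_iff (q := q) N a i (Fin.last N)).2 (by simp [i]; omega)
  have hE := (matE_pow_ne_zero_iff (q := q) N b (Fin.last N) j).2 (by simp [j]; omega)
  have hent : ∀ n : ℤ, rep q N (pbwMonomial q ((a, b), n)) i j =
      ((r : ℂ) ^ n) ^ N * ((matF q N ^ a) i (Fin.last N) * (matE q N ^ b) (Fin.last N) j) := by
    intro n
    have hrn : ((((q : ℝ) ^ (n * wt N (Fin.last N)) : ℝ)) : ℂ) = ((r : ℂ) ^ n) ^ N := by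
      have : (q : ℝ) ^ (n * wt N (Fin.last N)) = (r ^ n) ^ N := by
        rw [hr, ← Real.rpow_intCast, ← Real.rpow_natCast, ← Real.rpow_mul q.2.1.le,
          ← Real.rpow_mul q.2.1.le]
        congr 1
        simp only [wt, Fin.val_last]; ring
      rw [this]; push_cast; rfl
    rw [rep_pbwMonomial, Finset.sum_eq_single (Fin.last N), hrn]
    · ring
    · intro p _ hp
      have : ¬ (i : ℕ) + a = p := fun h => hp (Fin.ext (by rw [← h]; simp [i]; omega))
      rw [not_not.1 fun h => this ((matF_pow_ne_zero_iff N a i p).1 h), zero_mul]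
    · simp
  simp only [hent, smul_eq_mul, ← mul_assoc _ _ ((matF q N ^ a) i _ * _)] at hsum
  rw [← Finset.sum_mul] at hsum
  exact (mul_eq_zero.1 hsum).resolve_right (mul_ne_zero hF hE)

/-- The right regular representation is faithful. -/
theorem eq_of_rightRegular_eq {x y : Uq q} (h : ∀ s, rightRegular q x s = rightRegular q y s) :
    x = y := by
  refine sub_eq_zero.1 (eq_zero_of_rep_eq_zero fun N => ?_)
  rw [map_sub, sub_eq_zero]
  ext i j
  -- Evaluation at `1` recovers `t (x)` from `∂(x) t`.
  have h1 := congrArg (fun s : CSU2 q => (s : FullDual q) 1) (h (t q N i j))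
  simp only [rightRegular_apply, one_mul] at h1
  exact h1

end Separation

/-! ### Uniqueness of the equivariant coaction -/

section Uniqueness

variable {q : Set.Ioo (0 : ℝ) 1}

/-- The coefficient of `u ^ n` in an element of `V ⊗ ℂ[u, u⁻¹]`. -/
def tensorCoeff (V : Type*) [AddCommGroup V] [Module ℂ V] (n : ℤ) : V ⊗[ℂ] ℂ[T;T⁻¹] →ₗ[ℂ] V :=
  Finsupp.lapply n ∘ₗ
    (TensorProduct.equivFinsuppOfBasisRight (AddMonoidAlgebra.basis ℤ ℂ)).toLinearMap

theorem tensorCoeff_tmul {V : Type*} [AddCommGroup V] [Module ℂ V] (n : ℤ) (v : V)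
    (b : ℂ[T;T⁻¹]) : tensorCoeff V n (v ⊗ₜ b) = b.coeff n • v :=
  TensorProduct.equivFinsuppOfBasisRight_apply_tmul_apply ..

theorem tensor_ext_coeff {V : Type*} [AddCommGroup V] [Module ℂ V]
    {y z : V ⊗[ℂ] ℂ[T;T⁻¹]} (h : ∀ n, tensorCoeff V n y = tensorCoeff V n z) : y = z :=
  (TensorProduct.equivFinsuppOfBasisRight (AddMonoidAlgebra.basis ℤ ℂ)).injective (Finsupp.ext h)

theorem tensorCoeff_actB (n d : ℤ) (y : Uq q ⊗[ℂ] ℂ[T;T⁻¹]) (s : CSU2 q) :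
    tensorCoeff (CSU2 q) (n + d) (actB q y (s ⊗ₜ LaurentPolynomial.T d)) =
      rightRegular q (tensorCoeff (Uq q) n y) s := by
  induction y with
  | zero => simp
  | add y z hy hz => simp only [map_add, LinearMap.add_apply, hy, hz]
  | tmul x b =>
    rw [actB_tmul, tensorCoeff_tmul, tensorCoeff_tmul, map_smul, LinearMap.smul_apply]
    congr 1
    exact (AddMonoidAlgebra.coeff_mul_single_eq_coeff_mul n
      fun m _ => add_left_inj d).trans (mul_one _)

/-- An element of `U_q(su₂) ⊗ ℂ[u, u⁻¹]` is determined by its action on the image of the coaction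
on `ℂ[SU_{2,q}]`. -/
theorem eq_of_actB_coordCoaction_eq (k l : ℕ) {y z : Uq q ⊗[ℂ] ℂ[T;T⁻¹]}
    (h : ∀ s, actB q y (coordCoaction q k l s) = actB q z (coordCoaction q k l s)) : y = z := by
  refine tensor_ext_coeff fun n => eq_of_rightRegular_eq fun s => ?_
  have hs : s ∈ iSup (homogeneous q k l) := by rw [iSup_homogeneous]; trivial
  induction hs using Submodule.iSup_induction' with
  | mem d s hs =>
    rw [← tensorCoeff_actB n d, ← tensorCoeff_actB n d, ← coordCoaction_of_mem q k l hs, h]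
  | zero => rw [map_zero, map_zero]
  | add s r _ _ hs hr => rw [map_add, map_add, hs, hr]

theorem IsRightEquivariant.unique {k l : ℕ} {θ θ' : Uq q →ₗ[ℂ] Uq q ⊗[ℂ] ℂ[T;T⁻¹]}
    (h : IsRightEquivariant q k l θ) (h' : IsRightEquivariant q k l θ') : θ = θ' := by
  ext1 x
  refine eq_of_actB_coordCoaction_eq k l fun s => ?_
  rw [← h x s, ← h' x s]

end Uniqueness

end QuantumSU2

end

theorem proposition4 (q : Set.Ioo (0 : ℝ) 1) (k l : ℕ) (hk : 0 < k) (hl : 0 < l)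
    (hkl : Nat.Coprime k l) :
    ∃ θ : QuantumSU2.Uq q →ₐ[ℂ] QuantumSU2.Uq q ⊗[ℂ] ℂ[T;T⁻¹],
      QuantumSU2.IsCoaction θ.toLinearMap ∧
      QuantumSU2.IsRightEquivariant q k l θ.toLinearMap ∧
      θ (QuantumSU2.Uq.e q) =
        QuantumSU2.Uq.e q ⊗ₜ[ℂ] LaurentPolynomial.T (-(k : ℤ) - (l : ℤ)) ∧
      θ (QuantumSU2.Uq.f q) =
        QuantumSU2.Uq.f q ⊗ₜ[ℂ] LaurentPolynomial.T ((k : ℤ) + (l : ℤ)) ∧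
      θ (QuantumSU2.Uq.k q) = QuantumSU2.Uq.k q ⊗ₜ[ℂ] 1 ∧
      θ (QuantumSU2.Uq.kInv q) = QuantumSU2.Uq.kInv q ⊗ₜ[ℂ] 1 ∧
      ∀ θ' : QuantumSU2.Uq q →ₗ[ℂ] QuantumSU2.Uq q ⊗[ℂ] ℂ[T;T⁻¹],
        QuantumSU2.IsCoaction θ' → QuantumSU2.IsRightEquivariant q k l θ' →
          θ' = θ.toLinearMap := by
  have heq := QuantumSU2.isRightEquivariant_uqCoaction (q := q) k l
  refine ⟨QuantumSU2.uqCoaction q ((k : ℤ) + l), QuantumSU2.isCoaction_uqCoaction q _, heq, ?_,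
    QuantumSU2.uqCoaction_f q _, QuantumSU2.uqCoaction_k q _, QuantumSU2.uqCoaction_kInv q _,
    fun θ' _ h' => h'.unique heq⟩
  rw [QuantumSU2.uqCoaction_e, neg_add']
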